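/- Let $K$ be a quadratic field of discriminant $d_K<-4$ with ring of integers $\mathcal{O}_K$, let $\mathcal{O}$ be a (not necessarily maximal) order in $K$, and let $u=[\mathcal{O}_K:\mathcal{O}]$ be its conductor. Let $p$ be an odd prime that is unramified in $K$, let $n\ge 1$, and suppose that $N=p^n$ is prime to $u$. Let $R=\mathbf{Z}+N\mathcal{O}$, and let $$\varphi:\operatorname{cl}(R)\to\operatorname{cl}(\mathcal{O}),\qquad [I]\mapsto[I\mathcal{O}],$$ be the homomorphism of ideal class groups (invertible fractional ideals modulo principal ones) given by extension of ideals. Then $\ker\varphi$ is cyclic, of order $$p^{n-1}\Bigl(p-\Bigl(\frac{d_K}{p}\Bigr)\Bigr),$$ where $\bigl(\frac{d_K}{p}\bigr)$ is the Kronecker (here: Legendre) symbol, which is $1$ if $p$ splits in $K$ and $-1$ if $p$ is inert. -/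

import Mathlib

namespace QuadraticOrder

variable {K : Type*} [Field K]

/-- A subring `O` of `K` is an order in `K` if it is finitely generated as a `ℤ`-module and
contains a `ℚ`-basis of `K`. -/
structure IsOrder [CharZero K] (O : Subalgebra ℤ K) : Prop where
  fg : (Subalgebra.toSubmodule O).FG
  span_eq_top : Submodule.span ℚ (O : Set K) = ⊤

/-- The conductor of an order `O`: the index `[O_K : O]` of `O` in the maximal order. -/
noncomputable def conductor (O : Subalgebra ℤ K) : ℕ :=
  (Subalgebra.toSubmodule O).toAddSubgroup.relIndex
    (Subalgebra.toSubmodule (integralClosure ℤ K)).toAddSubgroup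

/-- The order `ℤ + N O`. -/
def intAddMul (N : ℕ) (O : Subalgebra ℤ K) : Subalgebra ℤ K where
  carrier := {x | ∃ a : ℤ, ∃ b ∈ O, x = (a : K) + (N : K) * b}
  mul_mem' := by
    rintro _ _ ⟨a, b, hb, rfl⟩ ⟨c, d, hd, rfl⟩
    refine ⟨a * c, (a : K) * d + (c : K) * b + (N : K) * (b * d), ?_, ?_⟩
    · exact add_mem (add_mem (mul_mem (intCast_mem O a) hd) (mul_mem (intCast_mem O c) hb))
        (mul_mem (natCast_mem O N) (mul_mem hb hd))
    · push_cast
      ring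
  add_mem' := by
    rintro _ _ ⟨a, b, hb, rfl⟩ ⟨c, d, hd, rfl⟩
    refine ⟨a + c, b + d, add_mem hb hd, ?_⟩
    push_cast
    ring
  algebraMap_mem' := fun r => ⟨r, 0, zero_mem O, by simp⟩

theorem intAddMul_le (N : ℕ) (O : Subalgebra ℤ K) : intAddMul N O ≤ O := by
  rintro _ ⟨a, b, hb, rfl⟩
  exact add_mem (intCast_mem O a) (mul_mem (natCast_mem O N) hb)

/-- For orders `A ⊆ B`, the homomorphism `cl(A) → cl(B)` that sends the class of an invertible
fractional `A`-ideal `I` to the class of `I B`. -/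
noncomputable def classGroupMap {A B : Subalgebra ℤ K} (h : A ≤ B) :
    ClassGroup A →* ClassGroup B :=
  letI : Algebra A B := (Subalgebra.inclusion h).toRingHom.toAlgebra
  haveI : Module.IsTorsionFree A B :=
    (Module.isTorsionFree_iff_algebraMap_injective).mpr (Subalgebra.inclusion_injective h)
  ClassGroup.extendedHom A B

end QuadraticOrder

/-! An invertible `R`-ideal in the kernel can be scaled so that it generates the unit ideal of `O`.
It then contains `N O`, and its image in `A = O / N O` is a line `ℤ α` with `α` a unit. Conversely
every unit `α` gives the invertible ideal `π⁻¹(ℤ α)`, which is principal exactly when `α` is a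
scalar, because `d_K < -4` leaves only `±1` as units of `O`. So the kernel is `Aˣ` modulo scalars
(`exists_hom_ker_classGroupMap`).

As `p` is odd and prime to `u`, `A` is `(ℤ/p^n)[√D]` with `D = u² d_K` prime to `p`
(`exists_quotient_ringEquiv`). Units modulo scalars are the points of the projective line over
`ℤ/p^n` at which the norm form is nonzero mod `p`; counting them gives the order (`card_of_ker`).

For cyclicity (`isCyclic_of_ker`), the quotient of `x` by its conjugate, taken mod `p`, maps this
group to the units of a field. The image is cyclic of order prime to `p`; the kernel has order
`p^(n-1)` and is generated by the class of `1 + p√D`. Coprimality of the two orders makes the whole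
group cyclic. -/

/-! ### Discriminant and units of a quadratic field -/

open NumberField in
/-- The ring of integers of a quadratic field lies in `½(ℤ + ℤ√d)` for `d` the discriminant. -/
theorem NumberField.exists_sq_eq_discr {K : Type*} [Field K] [NumberField K]
    (hK : Module.finrank ℚ K = 2) :
    ∃ θ : K, θ ^ 2 = (discr K : K) ∧
      ∀ x : K, IsIntegral ℤ x → ∃ t f : ℤ, 2 * x = t + f * θ := by
  classical
  have : Algebra.IsQuadraticExtension ℚ K := ⟨hK⟩
  have hcard : Nat.card (K ≃ₐ[ℚ] K) = 2 := by rw [IsGalois.card_aut_eq_finrank, hK]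
  obtain ⟨σ, hσ, huniq⟩ := (Nat.card_eq_two_iff' (1 : K ≃ₐ[ℚ] K)).1 hcard
  have huniv : (Finset.univ : Finset (K ≃ₐ[ℚ] K)) = {1, σ} := by
    ext τ
    by_cases h : τ = 1
    · simp [h]
    · simp [huniq τ h]
  let T : 𝓞 K → ℤ := Algebra.trace ℤ (𝓞 K)
  have hT (x : 𝓞 K) : (T x : K) = x + σ x := by
    have h1 := trace_eq_sum_automorphisms (K := ℚ) (x : K)
    rw [huniv, Finset.sum_pair hσ.symm, ← Algebra.coe_trace_int] at h1
    simpa using h1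
  have hrank : Module.finrank ℤ (𝓞 K) = 2 := by rw [RingOfIntegers.rank, hK]
  let b := Module.finBasisOfFinrankEq ℤ (𝓞 K) hrank
  have hdisc : (discr K : K) = (T (b 0 * b 0) : K) * T (b 1 * b 1) - (T (b 0 * b 1) : K) ^ 2 := by
    rw [← discr_eq_discr K b, Algebra.discr_def, Matrix.det_fin_two]
    simp only [Algebra.traceMatrix_apply, Algebra.traceForm_apply]
    rw [mul_comm (b 1) (b 0)]
    push_cast
    ring
  -- Since `T = 1 + σ`, this is `b₀ σ(b₁) - b₁ σ(b₀)`, the determinant of the conjugates of the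
  -- basis, whose square is the discriminant.
  refine ⟨b 0 * T (b 1) - b 1 * T (b 0), ?_, fun x hx => ?_⟩
  · rw [hdisc]
    simp only [hT, map_mul]
    ring
  · let X : 𝓞 K := ⟨x, hx⟩
    have key (z : 𝓞 K) : (z : K) = (b.repr z 0 : K) * b 0 + (b.repr z 1 : K) * b 1 := by
      have := congrArg (fun y : 𝓞 K => (y : K)) (b.sum_repr z)
      simp only [Fin.sum_univ_two] at this
      rw [← this]
      simp
    have hX := key X
    have h1 := key 1
    have hTX := hT X
    have hσX := congrArg σ hX
    have hσ1 := congrArg σ h1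
    simp only [map_one, map_mul, map_add, map_intCast] at hσX hσ1 h1
    -- From `2x = T x + (x - σ x)`: the difference is the determinant of the conjugates of `x` and
    -- `1`, hence `θ` times the determinant of their coordinates.
    refine ⟨T X, b.repr X 0 * b.repr 1 1 - b.repr X 1 * b.repr 1 0, ?_⟩
    have : 2 * x = T X + ((X : K) * 1 - σ X * 1) := by
      rw [hTX]; change 2 * x = x + _ + (x * 1 - _); ring
    rw [this]
    simp only [hT]
    push_cast
    congr 1
    linear_combination (X : K) * hσ1 - σ X * h1
      + ((b.repr 1 0 : K) * σ (b 0) + (b.repr 1 1 : K) * σ (b 1)) * hX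
      - ((b.repr 1 0 : K) * b 0 + (b.repr 1 1 : K) * b 1) * hσX

theorem Int.cast_add_mul_eq_zero {K : Type*} [Field K] [CharZero K] {θ : K} {d : ℤ}
    (hθ : θ ^ 2 = (d : K)) (hd : d < 0) {a b : ℤ} (h : (a : K) + b * θ = 0) : a = 0 ∧ b = 0 := by
  have h2 : (a : K) ^ 2 = b ^ 2 * d := by
    rw [← hθ]
    linear_combination (a - b * θ) * h
  have h3 : a ^ 2 = b ^ 2 * d := by exact_mod_cast h2
  have hb : b = 0 := by
    by_contra hb
    have := sq_nonneg a
    have : 0 < b ^ 2 := by positivity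
    nlinarith
  subst hb
  exact ⟨by simpa using h, rfl⟩

-- Write `2c = t + fθ` and `2c⁻¹ = s + gθ`. Taking norms, `(t² - f²d)(s² - g²d) = 16`. If `f ≠ 0`
-- then also `g ≠ 0`, and `-d ≥ 5` makes both factors at least `5`, which is impossible. So `c` and
-- its inverse are rational integers.
open NumberField in
theorem NumberField.eq_one_or_neg_one_of_isIntegral_inv {K : Type*} [Field K] [NumberField K]
    (hK : Module.finrank ℚ K = 2) (hd : discr K < -4) {c : K} (hc0 : c ≠ 0)
    (hc : IsIntegral ℤ c) (hc' : IsIntegral ℤ c⁻¹) : c = 1 ∨ c = -1 := by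
  obtain ⟨θ, hθ, hhalf⟩ := exists_sq_eq_discr hK
  have hirr (a b : ℤ) (h : (a : K) + b * θ = 0) : b = 0 :=
    (Int.cast_add_mul_eq_zero hθ (by linarith) h).2
  obtain ⟨t, f, h1⟩ := hhalf c hc
  obtain ⟨s, g, h2⟩ := hhalf c⁻¹ hc'
  have h4 : (4 : K) = (t + f * θ) * (s + g * θ) := by
    rw [← h1, ← h2]
    field_simp
    norm_num
  have h5 : t * g + f * s = 0 := by
    refine hirr (t * s + f * g * discr K - 4) _ ?_
    push_cast
    rw [← hθ]
    linear_combination -h4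
  have h6 : t * s + f * g * discr K = 4 := by
    have h5' : (t * g + f * s : K) = 0 := by exact_mod_cast h5
    have : (t * s + f * g * discr K : K) = 4 := by
      rw [← hθ]
      linear_combination -h4 - θ * h5'
    exact_mod_cast this
  have hf : f = 0 := by
    by_contra hf
    have hg : g ≠ 0 := by
      rintro rfl
      simp only [mul_zero, zero_add, mul_eq_zero, hf, false_or] at h5
      simp [h5] at h6
    have hf2 : 1 ≤ f ^ 2 := by
      have : 0 < f ^ 2 := by positivity
      omega
    have hg2 : 1 ≤ g ^ 2 := by
      have : 0 < g ^ 2 := by positivity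
      omega
    have e1 : 5 ≤ t ^ 2 - f ^ 2 * discr K := by nlinarith [sq_nonneg t]
    have e2 : 5 ≤ s ^ 2 - g ^ 2 * discr K := by nlinarith [sq_nonneg s]
    have e3 : (t ^ 2 - f ^ 2 * discr K) * (s ^ 2 - g ^ 2 * discr K) = 16 := by
      linear_combination (t * s + f * g * discr K + 4) * h6 - (t * g + f * s) * discr K * h5
    nlinarith
  have hg : g = 0 := by
    subst hf
    simp only [zero_mul, add_zero] at h5 h6
    rcases mul_eq_zero.1 h5 with h | h
    · simp [h] at h6
    · exact h
  have hrat (q : ℚ) (h : IsIntegral ℤ (algebraMap ℚ K q)) : ∃ z : ℤ, (z : ℚ) = q := by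
    rw [isIntegral_algebraMap_iff (algebraMap ℚ K).injective] at h
    obtain ⟨z, hz⟩ := IsIntegrallyClosed.isIntegral_iff.1 h
    exact ⟨z, by simpa using hz⟩
  have hc1 : c = algebraMap ℚ K (t / 2) := by
    rw [map_div₀]
    simp only [map_intCast, map_ofNat]
    rw [eq_div_iff two_ne_zero, mul_comm, h1, hf]
    simp
  have hc2 : c⁻¹ = algebraMap ℚ K (s / 2) := by
    rw [map_div₀]
    simp only [map_intCast, map_ofNat]
    rw [eq_div_iff two_ne_zero, mul_comm, h2, hg]
    simp
  obtain ⟨z, hz⟩ := hrat _ (hc1 ▸ hc)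
  obtain ⟨w, hw⟩ := hrat _ (hc2 ▸ hc')
  rw [← hz] at hc1
  rw [← hw] at hc2
  have hzw : z * w = 1 := by
    have : c * c⁻¹ = 1 := mul_inv_cancel₀ hc0
    rw [hc2, hc1] at this
    simp only [map_intCast] at this
    exact_mod_cast this
  rcases Int.eq_one_or_neg_one_of_mul_eq_one hzw with rfl | rfl
  · left; simp [hc1]
  · right; simp [hc1]

/-! ### Reduction from `ℤ/p^n` to `ℤ/p` -/

namespace ZMod

variable {p : ℕ} [Fact p.Prime] {n : ℕ}

theorem castHom_pow_surjective (hn : n ≠ 0) :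
    Function.Surjective (castHom (dvd_pow_self p hn) (ZMod p)) :=
  ZMod.ringHom_surjective _

theorem isUnit_iff_castHom_ne_zero (hn : n ≠ 0) (a : ZMod (p ^ n)) :
    IsUnit a ↔ castHom (dvd_pow_self p hn) (ZMod p) a ≠ 0 := by
  have hp : p.Prime := Fact.out
  have : NeZero (p ^ n) := ⟨pow_ne_zero n hp.ne_zero⟩
  obtain ⟨k, rfl⟩ := ZMod.natCast_zmod_surjective a
  rw [ZMod.isUnit_iff_coprime, Nat.coprime_pow_right_iff (Nat.pos_of_ne_zero hn), map_natCast,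
    Ne, ZMod.natCast_eq_zero_iff, Nat.coprime_comm, hp.coprime_iff_not_dvd]

/-- All fibres of a surjective homomorphism have the same size, here `p^n / p`. -/
theorem card_castHom_mem (hn : n ≠ 0) (S : Set (ZMod p)) :
    Nat.card {a : ZMod (p ^ n) // castHom (dvd_pow_self p hn) (ZMod p) a ∈ S} =
      p ^ (n - 1) * Nat.card S := by
  classical
  have hp : p.Prime := Fact.out
  have : NeZero (p ^ n) := ⟨pow_ne_zero n hp.ne_zero⟩
  set φ := castHom (dvd_pow_self p hn) (ZMod p)
  have hsurj : Function.Surjective φ := castHom_pow_surjective hn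
  have hfib (x y : ZMod p) : Finset.card {a | φ a = x} = Finset.card {a | φ a = y} :=
    AddMonoidHom.card_fiber_eq_of_mem_range φ (hsurj x) (hsurj y)
  have hall (T : Finset (ZMod p)) :
      Finset.card {a | φ a ∈ T} = T.card * Finset.card {a | φ a = 0} := by
    rw [Finset.card_eq_sum_card_fiberwise (f := φ) (t := T) (fun a ha => by simpa using ha),
      Finset.sum_const_nat]
    intro x hx
    rw [← hfib x 0]
    congr 1
    ext a
    simp only [Finset.mem_filter, Finset.mem_univ, true_and, and_iff_right_iff_imp]
    rintro rfl
    exact hx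
  have hker : Finset.card {a | φ a = 0} = p ^ (n - 1) := by
    have h := hall Finset.univ
    simp only [Finset.mem_univ, Finset.filter_true, Finset.card_univ, ZMod.card] at h
    refine Nat.eq_of_mul_eq_mul_left hp.pos (h.symm.trans ?_)
    rw [mul_pow_sub_one hn]
  rw [Nat.card_eq_fintype_card, Nat.card_eq_fintype_card, Fintype.card_subtype,
    ← Set.toFinset_card, mul_comm, ← hker, ← hall]
  congr 1
  ext a
  simp

end ZMod

/-! ### Units of `(ℤ/p^n)[√D]` modulo scalars -/

namespace QuadraticAlgebra

theorem im_eq_zero_iff_of_mul_star {R : Type*} [CommRing R] {D : R} (x y : QuadraticAlgebra R D 0) :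
    (x * star y).im = 0 ↔ x.im * y.re = x.re * y.im := by
  simp only [im_mul, re_star, im_star]
  constructor <;> intro h <;> linear_combination h

section Torus

variable {R : Type*} [CommRing R] {D : R} {G : Type*} [CommGroup G]
  {f : (QuadraticAlgebra R D 0)ˣ →* G}

/-- `y * star y` is a scalar, so `f (star y)` inverts `f y`, and equality of classes means that `x *
star y` is a scalar: the fibres of `f` are points of a projective line. -/
theorem eq_iff_of_ker (hker : ∀ x, f x = 1 ↔ (x : QuadraticAlgebra R D 0).im = 0)
    (x y : (QuadraticAlgebra R D 0)ˣ) :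
    f x = f y ↔ (x.val.im * y.val.re = x.val.re * y.val.im) := by
  have h1 : f (y * star y) = 1 := by
    rw [hker, Units.val_mul, Units.coe_star, im_eq_zero_iff_of_mul_star, mul_comm]
  rw [← im_eq_zero_iff_of_mul_star, ← Units.coe_star, ← Units.val_mul, ← hker, map_mul,
    ← h1, map_mul, mul_left_inj]

end Torus

variable {p : ℕ} [Fact p.Prime] {n : ℕ}

open ZMod in
theorem isUnit_iff_castHom_norm (hn : n ≠ 0) {D : ZMod (p ^ n)}
    (x : QuadraticAlgebra (ZMod (p ^ n)) D 0) :
    IsUnit x ↔ castHom (dvd_pow_self p hn) (ZMod p) x.re ^ 2 ≠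
      castHom (dvd_pow_self p hn) (ZMod p) D * castHom (dvd_pow_self p hn) (ZMod p) x.im ^ 2 := by
  rw [isUnit_iff_norm_isUnit, isUnit_iff_castHom_ne_zero hn, norm_def, Ne, Ne, ← sub_eq_zero (b := _ * _ ^ 2)]
  simp only [map_sub, map_add, map_mul, map_zero]
  ring_nf

/-- The evaluation `a + b ω ↦ j a + j b * d` at a square root `d` of `D`. -/
def evalHom {R S : Type*} [CommRing R] [CommRing S] {D : R} (j : R →+* S) {d : S}
    (hd : d ^ 2 = j D) : QuadraticAlgebra R D 0 →+* S where
  toFun x := j x.re + j x.im * d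
  map_one' := by simp
  map_zero' := by simp
  map_add' x y := by simp only [re_add, im_add, map_add]; ring
  map_mul' x y := by
    simp only [re_mul, im_mul, map_add, map_mul, map_zero]
    rw [← hd]
    ring

theorem evalHom_apply {R S : Type*} [CommRing R] [CommRing S] {D : R} (j : R →+* S) {d : S}
    (hd : d ^ 2 = j D) (x : QuadraticAlgebra R D 0) : evalHom j hd x = j x.re + j x.im * d := rfl

section Card

variable {D : ℤ} {G : Type*} [CommGroup G]
  {f : (QuadraticAlgebra (ZMod (p ^ n)) (D : ZMod (p ^ n)) 0)ˣ →* G}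

open ZMod

/-- Representatives `a + ω` and `1 + b ω` of the units modulo scalars. -/
noncomputable def torusRep (hn : n ≠ 0) :
    {a : ZMod (p ^ n) // castHom (dvd_pow_self p hn) (ZMod p) a ∈ {y : ZMod p | y ^ 2 ≠ D}} ⊕
      {b : ZMod (p ^ n) // castHom (dvd_pow_self p hn) (ZMod p) b ∈ ({0} : Set (ZMod p))} →
    (QuadraticAlgebra (ZMod (p ^ n)) (D : ZMod (p ^ n)) 0)ˣ
  | .inl a => IsUnit.unit (a := ⟨a, 1⟩) <| (isUnit_iff_castHom_norm hn _).2 <| by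
      simpa [-castHom_apply] using a.2
  | .inr b => IsUnit.unit (a := ⟨1, b⟩) <| (isUnit_iff_castHom_norm hn _).2 <| by
      have := b.2
      rw [Set.mem_singleton_iff] at this
      simp [this, -castHom_apply]

theorem exists_torusRep_inr (hn : n ≠ 0)
    (hker : ∀ x, f x = 1 ↔ (x : QuadraticAlgebra (ZMod (p ^ n)) (D : ZMod (p ^ n)) 0).im = 0)
    (x : (QuadraticAlgebra (ZMod (p ^ n)) (D : ZMod (p ^ n)) 0)ˣ)
    (hx : castHom (dvd_pow_self p hn) (ZMod p) x.val.im = 0) :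
    ∃ b, f (torusRep hn (.inr b)) = f x := by
  have hu := (isUnit_iff_castHom_norm hn _).1 x.isUnit
  rw [hx] at hu
  have hre : IsUnit x.val.re := by
    rw [isUnit_iff_castHom_ne_zero hn]
    intro h
    simp [h] at hu
  obtain ⟨r, hr⟩ := hre
  refine ⟨⟨x.val.im * r⁻¹.val, ?_⟩, ?_⟩
  · rw [Set.mem_singleton_iff, map_mul, hx, zero_mul]
  · rw [eq_iff_of_ker hker]
    simp only [torusRep, IsUnit.unit_spec, one_mul]
    rw [← hr, mul_assoc, Units.inv_mul, mul_one]

/-- If the `ω`-coordinate is a unit, scale it to `1`; otherwise the norm condition makes the other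
coordinate a unit, and that one is scaled to `1`. The two families are disjoint because `a * b = 1`
fails mod `p` when `b` reduces to `0`. -/
theorem torusRep_bijective (hn : n ≠ 0) (hf : Function.Surjective f)
    (hker : ∀ x, f x = 1 ↔ (x : QuadraticAlgebra (ZMod (p ^ n)) (D : ZMod (p ^ n)) 0).im = 0) :
    Function.Bijective fun s => f (torusRep (D := D) hn s) := by
  constructor
  · rintro (⟨a, ha⟩ | ⟨a, ha⟩) (⟨b, hb⟩ | ⟨b, hb⟩) h <;>
    simp only [eq_iff_of_ker hker, torusRep, IsUnit.unit_spec, one_mul, mul_one] at h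
    · simp [h]
    · have := congrArg (castHom (dvd_pow_self p hn) (ZMod p)) h
      rw [Set.mem_singleton_iff] at hb
      simp [hb, -castHom_apply] at this
    · have := congrArg (castHom (dvd_pow_self p hn) (ZMod p)) h
      rw [Set.mem_singleton_iff] at ha
      simp [ha, -castHom_apply] at this
    · simp [h]
  · intro g
    obtain ⟨x, rfl⟩ := hf g
    by_cases hx : castHom (dvd_pow_self p hn) (ZMod p) x.val.im = 0
    · obtain ⟨b, hb⟩ := exists_torusRep_inr hn hker x hx
      exact ⟨.inr b, hb⟩
    · have hu := (isUnit_iff_castHom_norm hn _).1 x.isUnit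
      obtain ⟨r, hr⟩ := (isUnit_iff_castHom_ne_zero hn _).2 hx
      refine ⟨.inl ⟨x.val.re * r⁻¹.val, ?_⟩, ?_⟩
      · intro h
        apply hu
        rw [map_mul, mul_pow, ← map_intCast (castHom (dvd_pow_self p hn) (ZMod p))] at h
        rw [← h, ← hr, mul_assoc, ← mul_pow, ← map_mul, Units.inv_mul]
        simp [-castHom_apply]
      · simp only [eq_iff_of_ker hker, torusRep, IsUnit.unit_spec, one_mul]
        rw [← hr, mul_assoc, Units.inv_mul, mul_one]

/-- `y² = D` has `1 + (D/p)` roots mod `p`, so the two families have `p^(n-1) (p - 1 - (D/p))` and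
`p^(n-1)` members. -/
theorem card_of_ker (hn : n ≠ 0) (hp : p ≠ 2) (hf : Function.Surjective f)
    (hker : ∀ x, f x = 1 ↔ (x : QuadraticAlgebra (ZMod (p ^ n)) (D : ZMod (p ^ n)) 0).im = 0) :
    (Nat.card G : ℤ) = (p : ℤ) ^ (n - 1) * (p - legendreSym p D) := by
  classical
  have hp1 : 1 ≤ p := (Fact.out : p.Prime).one_le
  have : NeZero (p ^ n) := ⟨pow_ne_zero n (Fact.out : p.Prime).ne_zero⟩
  have hS : (Nat.card {y : ZMod p | y ^ 2 ≠ D} : ℤ) = p - 1 - legendreSym p D := by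
    have h1 := legendreSym.card_sqrts p hp D
    have h2 := Finset.card_add_card_compl {y : ZMod p | y ^ 2 = D}.toFinset
    rw [ZMod.card, ← Set.toFinset_compl] at h2
    rw [Nat.card_eq_fintype_card, ← Set.toFinset_card]
    have h3 : {y : ZMod p | y ^ 2 ≠ D} = {y : ZMod p | y ^ 2 = D}ᶜ := rfl
    simp only [h3]
    zify at h2
    linarith
  rw [← Nat.card_eq_of_bijective _ (torusRep_bijective hn hf hker), Nat.card_sum,
    card_castHom_mem hn, card_castHom_mem hn, Nat.cast_add, Nat.cast_mul, Nat.cast_mul, hS,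
    Nat.card_unique]
  push_cast
  ring

/-- With `d² = D` in the algebraic closure, `χ` is `(a + bd)/(a - bd)` mod `p`. It kills scalars, so
it descends to `G`; it equals `1` iff `2bd = 0`, and `2d ≠ 0`. -/
theorem exists_monoidHom_ker (hn : n ≠ 0) (hp : p ≠ 2) (hD : (D : ZMod p) ≠ 0)
    (hf : Function.Surjective f)
    (hker : ∀ x, f x = 1 ↔ (x : QuadraticAlgebra (ZMod (p ^ n)) (D : ZMod (p ^ n)) 0).im = 0) :
    ∃ χ : G →* (AlgebraicClosure (ZMod p))ˣ, ∀ x,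
      χ (f x) = 1 ↔ castHom (dvd_pow_self p hn) (ZMod p) x.val.im = 0 := by
  let L := AlgebraicClosure (ZMod p)
  obtain ⟨d, hd⟩ := IsAlgClosed.exists_pow_nat_eq (D : L) two_pos
  let j : ZMod (p ^ n) →+* L := (algebraMap (ZMod p) L).comp (castHom (dvd_pow_self p hn) (ZMod p))
  have hj : d ^ 2 = j D := by rw [hd, map_intCast]
  have hj' : (-d) ^ 2 = j D := by rw [neg_sq, hj]
  let χ' : (QuadraticAlgebra (ZMod (p ^ n)) (D : ZMod (p ^ n)) 0)ˣ →* Lˣ :=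
    Units.map (evalHom j hj).toMonoidHom / Units.map (evalHom j hj').toMonoidHom
  have hd0 : d ≠ 0 := by
    rintro rfl
    apply hD
    apply (algebraMap (ZMod p) L).injective
    rw [map_intCast, ← hd, map_zero]
    simp
  have h20 : (2 : L) ≠ 0 := by
    have : (2 : ZMod p) ≠ 0 := by
      intro h
      have h' : ((2 : ℕ) : ZMod p) = 0 := by exact_mod_cast h
      rw [ZMod.natCast_eq_zero_iff] at h'
      exact hp ((Nat.prime_dvd_prime_iff_eq Fact.out Nat.prime_two).1 h')
    intro h
    apply this
    apply (algebraMap (ZMod p) L).injective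
    rw [map_ofNat, h, map_zero]
  have hχ' (x) : χ' x = 1 ↔ castHom (dvd_pow_self p hn) (ZMod p) x.val.im = 0 := by
    rw [MonoidHom.div_apply, div_eq_one, Units.ext_iff, Units.coe_map, Units.coe_map]
    change evalHom j hj x.val = evalHom j hj' x.val ↔ _
    simp only [evalHom_apply, j, RingHom.comp_apply]
    rw [← (algebraMap (ZMod p) L).injective.eq_iff, map_zero]
    constructor
    · intro h
      have : 2 * d * algebraMap (ZMod p) L (castHom (dvd_pow_self p hn) (ZMod p) x.val.im) = 0 := by
        linear_combination h
      simpa [h20, hd0, -castHom_apply] using this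
    · intro h
      rw [h]
      ring
  refine ⟨f.liftOfSurjective hf ⟨χ', fun x hx => ?_⟩, fun x => ?_⟩
  · rw [MonoidHom.mem_ker, hker] at hx
    rw [MonoidHom.mem_ker, hχ', hx, map_zero]
  · rw [← hχ']
    congr! 1
    exact f.liftOfRightInverse_comp_apply _ _ _ _

/-- The shape of the powers of `a + q b ω` modulo `q ^ 3`. -/
theorem exists_pow_eq_mk (D a b q : ℤ) (m : ℕ) : ∃ k l : ℤ,
    ((⟨a, q * b⟩ : QuadraticAlgebra ℤ D 0) ^ (m + 1)) =
      ⟨a ^ (m + 1) + q ^ 2 * k, (m + 1) * a ^ m * q * b + q ^ 3 * l⟩ := by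
  induction m with
  | zero => exact ⟨0, 0, by ext <;> simp⟩
  | succ m ih =>
    obtain ⟨k, l, h⟩ := ih
    refine ⟨k * a + D * ((m + 1) * a ^ m * b * b + q ^ 2 * l * b), k * b + l * a, ?_⟩
    rw [pow_succ, h]
    ext
    · simp only [re_mul]
      ring
    · simp only [im_mul]
      push_cast
      ring

/-- Each `p`-th power raises the valuation of the `ω`-coordinate by exactly one, since the error
term in `exists_pow_eq_mk` is cubic in `q = p^(k+1)`. -/
theorem exists_one_add_pow_prime_pow (D : ℤ) (k : ℕ) : ∃ a b : ℤ,
    ¬ (p : ℤ) ∣ a ∧ ¬ (p : ℤ) ∣ b ∧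
      ((⟨1, p⟩ : QuadraticAlgebra ℤ D 0) ^ p ^ k) = ⟨a, p ^ (k + 1) * b⟩ := by
  have hpp : p.Prime := Fact.out
  have hpi : Prime (p : ℤ) := Nat.prime_iff_prime_int.1 hpp
  induction k with
  | zero =>
    exact ⟨1, 1, hpi.not_dvd_one, hpi.not_dvd_one, by simp⟩
  | succ k ih =>
    obtain ⟨a, b, ha, hb, h⟩ := ih
    obtain ⟨r, l, h'⟩ := exists_pow_eq_mk D a b (p ^ (k + 1)) (p - 1)
    rw [Nat.sub_add_cancel hpp.one_le, ← h, ← pow_mul, ← pow_succ] at h'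
    have hp1 : ((p - 1 : ℕ) : ℤ) + 1 = p := by
      have := hpp.one_le
      omega
    -- The exponent `2k + 1` is `3(k + 1) - (k + 2)`, left after `p^(k+2)` is factored out.
    refine ⟨a ^ p + (p ^ (k + 1)) ^ 2 * r, a ^ (p - 1) * b + p ^ (2 * k + 1) * l, ?_, ?_, h'.trans ?_⟩
    · rw [← pow_mul]
      intro hdvd
      rw [Int.dvd_add_left (Dvd.dvd.mul_right (dvd_pow_self _ (by omega)) _)] at hdvd
      exact ha (hpi.dvd_of_dvd_pow hdvd)
    · intro hdvd
      rw [Int.dvd_add_left (Dvd.dvd.mul_right (dvd_pow_self _ (by omega)) _)] at hdvd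
      exact (hpi.dvd_or_dvd hdvd).elim (fun h => ha (hpi.dvd_of_dvd_pow h)) hb
    · rw [hp1]
      congr 1
      ring

/-- Reduction of coefficients. -/
def mapInt (D : ℤ) (N : ℕ) :
    QuadraticAlgebra ℤ D 0 →+* QuadraticAlgebra (ZMod N) (D : ZMod N) 0 where
  toFun x := ⟨x.re, x.im⟩
  map_one' := by ext <;> simp
  map_zero' := by ext <;> simp
  map_add' x y := by ext <;> simp
  map_mul' x y := by ext <;> simp

/-- For `x = 1 + pω`, the power `x^(p^k)` is a scalar iff `p^n` divides `p^(k+1) b` with `b` prime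
to `p`, that is, iff `n ≤ k + 1`. -/
theorem exists_orderOf_eq (hn : n ≠ 0)
    (hker : ∀ x, f x = 1 ↔ (x : QuadraticAlgebra (ZMod (p ^ n)) (D : ZMod (p ^ n)) 0).im = 0) :
    ∃ x, castHom (dvd_pow_self p hn) (ZMod p) x.val.im = 0 ∧ orderOf (f x) = p ^ (n - 1) := by
  have hpp : p.Prime := Fact.out
  let x := torusRep (p := p) (n := n) (D := D) hn (.inr ⟨p, by rw [Set.mem_singleton_iff, map_natCast, ZMod.natCast_self]⟩)
  have hx : x.val = mapInt D (p ^ n) ⟨1, p⟩ := by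
    simp only [x, torusRep, IsUnit.unit_spec]
    ext <;> simp [mapInt]
  have hpow (k : ℕ) : ∃ b : ℤ, ¬ (p : ℤ) ∣ b ∧
      (x ^ p ^ k).val.im = ((p ^ (k + 1) * b : ℤ) : ZMod (p ^ n)) := by
    obtain ⟨a, b, -, hb, h⟩ := exists_one_add_pow_prime_pow (p := p) D k
    refine ⟨b, hb, ?_⟩
    rw [Units.val_pow_eq_pow_val, hx, ← map_pow, h]
    rfl
  have hone (k : ℕ) : f x ^ p ^ k = 1 ↔ n ≤ k + 1 := by
    obtain ⟨b, hb, h⟩ := hpow k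
    rw [← map_pow, hker, h, ZMod.intCast_zmod_eq_zero_iff_dvd, Nat.cast_pow]
    constructor
    · intro hd
      by_contra! hlt
      have h2 : (p : ℤ) ^ (k + 1) * p ∣ p ^ (k + 1) * b :=
        (pow_succ (p : ℤ) (k + 1) ▸ pow_dvd_pow _ hlt).trans hd
      exact hb (Int.dvd_of_mul_dvd_mul_left (pow_ne_zero _ (by exact_mod_cast hpp.ne_zero)) h2)
    · intro hle
      exact (pow_dvd_pow _ hle).mul_right _
  refine ⟨x, by simp [x, torusRep, -castHom_apply], ?_⟩
  obtain ⟨m, rfl⟩ := Nat.exists_eq_succ_of_ne_zero hn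
  cases m with
  | zero => simpa using (hone 0).2 le_rfl
  | succ m =>
    refine orderOf_eq_prime_pow ?_ ?_
    · rw [hone]
      omega
    · rw [hone]

/-- The kernel of `χ` has order `p^(n-1)`: the classes of `1 + bω` exhaust it, and it contains an
element of that order. The image is a finite group of units of a field. An element generating the
kernel times a suitable power of a lift of a generator of the image generates `G`. -/
theorem isCyclic_of_ker (hn : n ≠ 0) (hp : p ≠ 2) (hD : (D : ZMod p) ≠ 0)
    (hf : Function.Surjective f)
    (hker : ∀ x, f x = 1 ↔ (x : QuadraticAlgebra (ZMod (p ^ n)) (D : ZMod (p ^ n)) 0).im = 0) :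
    IsCyclic G := by
  have hpp : p.Prime := Fact.out
  have : NeZero (p ^ n) := ⟨pow_ne_zero n hpp.ne_zero⟩
  have hfin : Finite G := Finite.of_surjective _ (torusRep_bijective hn hf hker).2
  obtain ⟨χ, hχ⟩ := exists_monoidHom_ker hn hp hD hf hker
  obtain ⟨x, hx, hord⟩ := exists_orderOf_eq hn hker
  have hle : Nat.card χ.ker ≤ p ^ (n - 1) := by
    have h1 := card_castHom_mem (p := p) hn {0}
    have h2 : Nat.card ({0} : Set (ZMod p)) = 1 := Nat.card_unique
    rw [h2, mul_one] at h1
    rw [← h1]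
    refine Nat.card_le_card_of_surjective (fun b => ⟨f (torusRep hn (.inr b)), ?_⟩) ?_
    · rw [MonoidHom.mem_ker, hχ]
      exact b.2
    · rintro ⟨g, hg⟩
      obtain ⟨y, rfl⟩ := hf g
      rw [MonoidHom.mem_ker, hχ] at hg
      obtain ⟨b, hb⟩ := exists_torusRep_inr hn hker y hg
      exact ⟨b, Subtype.ext hb⟩
  have hkercard : Nat.card χ.ker = p ^ (n - 1) := by
    refine le_antisymm hle ?_
    rw [← hord, ← Nat.card_zpowers]
    refine Nat.card_le_card_of_injective (Subgroup.inclusion ?_) (Subgroup.inclusion_injective _)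
    rw [Subgroup.zpowers_le, MonoidHom.mem_ker, hχ, hx]
  have hprod : Nat.card χ.range * p ^ (n - 1) = Nat.card G := by
    rw [← hkercard, ← Subgroup.index_ker, mul_comm, Subgroup.card_mul_index]
  -- In characteristic `p`, `g^p = 1` forces `(g - 1)^p = 0`, so the image has no element of order
  -- `p`.
  have hcop : (p ^ (n - 1)).Coprime (Nat.card χ.range) := by
    refine Nat.Coprime.pow_left _ ((Nat.Prime.coprime_iff_not_dvd hpp).2 fun hdvd => ?_)
    have : Finite χ.range := Finite.of_surjective _ χ.rangeRestrict_surjective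
    obtain ⟨⟨g, hg⟩, hgo⟩ := exists_prime_orderOf_dvd_card' p hdvd
    rw [Subgroup.orderOf_mk] at hgo
    have h1 : g ^ p = 1 := by
      have := pow_orderOf_eq_one g
      rwa [hgo] at this
    have h2 : g = 1 := by
      ext
      have h3 : (g : AlgebraicClosure (ZMod p)) ^ p = 1 := by
        rw [← Units.val_pow_eq_pow_val, h1, Units.val_one]
      have h4 : ((g : AlgebraicClosure (ZMod p)) - 1) ^ p = 0 := by
        rw [sub_pow_char, h3, one_pow, sub_self]
      exact sub_eq_zero.1 (pow_eq_zero_iff hpp.ne_zero |>.1 h4)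
    rw [h2, orderOf_one] at hgo
    exact hpp.one_lt.ne hgo
  have : Finite χ.range := Finite.of_surjective _ χ.rangeRestrict_surjective
  obtain ⟨y, hg⟩ := (inferInstance : IsCyclic χ.range).exists_ofOrder_eq_natCard
  obtain ⟨g, hgy⟩ := y.2
  rw [← Subgroup.orderOf_coe, ← hgy] at hg
  -- Lagrange bounds the order from above; from below, `χ` preserves it, as raising to a power of
  -- `p` does not change orders prime to `p`.
  have hg' : orderOf (g ^ p ^ (n - 1)) = Nat.card χ.range := by
    refine Nat.dvd_antisymm ?_ ?_
    · rw [orderOf_dvd_iff_pow_eq_one, ← pow_mul, mul_comm, hprod, pow_card_eq_one']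
    · have := orderOf_map_dvd χ (g ^ p ^ (n - 1))
      rwa [map_pow, Nat.Coprime.orderOf_pow (hg ▸ hcop.symm), hg] at this
  refine isCyclic_of_orderOf_eq_card (f x * g ^ p ^ (n - 1)) ?_
  rw [(Commute.all _ _).orderOf_mul_eq_mul_orderOf_of_coprime (by rwa [hord, hg']), hord, hg',
    mul_comm, hprod]

end Card
end QuadraticAlgebra

/-! ### Extension of ideal classes inside a given fraction field -/

open scoped nonZeroDivisors

/-- Turns a change of fraction field into an extension along the identity, so that it commutes with
extension to a larger ring by `extended_extended`. -/
theorem FractionalIdeal.canonicalEquiv_eq_extended {R P P' : Type*} [CommRing R] {S : Submonoid R}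
    [CommRing P] [Algebra R P] [IsLocalization S P] [CommRing P'] [Algebra R P']
    [IsLocalization S P'] (I : FractionalIdeal S P) :
    canonicalEquiv S P P' I =
      I.extended P' (show S ≤ S.comap (RingHom.id R) from fun _ h => h) := by
  ext x
  rw [mem_canonicalEquiv_apply, mem_extended_iff]
  constructor
  · rintro ⟨y, hy, rfl⟩
    exact Submodule.subset_span ⟨y, hy, rfl⟩
  · intro hx
    have : Submodule.span R (IsLocalization.map P' (RingHom.id R)
        (show S ≤ S.comap (RingHom.id R) from fun _ h => h) '' (I : Set P)) ≤
        (canonicalEquiv S P P' I : Submodule R P') := by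
      rw [Submodule.span_le]
      rintro _ ⟨y, hy, rfl⟩
      exact (mem_canonicalEquiv_apply _ _ _).2 ⟨y, hy, rfl⟩
    exact (mem_canonicalEquiv_apply _ _ _).1 (this hx)

theorem ClassGroup.extendedHom_mk_of_isFractionRing {A B : Type*} (K L : Type*) [CommRing A]
    [IsDomain A] [CommRing B] [IsDomain B] [Algebra A B] [Module.IsTorsionFree A B]
    [Field K] [Algebra A K] [IsFractionRing A K] [Field L] [Algebra B L] [IsFractionRing B L]
    (I : (FractionalIdeal A⁰ K)ˣ) :
    ClassGroup.extendedHom A B (ClassGroup.mk K I) =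
      ClassGroup.mk L (Units.map (FractionalIdeal.extendedHom L B).toMonoidHom I) := by
  rw [← ClassGroup.mk_canonicalEquiv K (FractionRing A), ClassGroup.extendedHom_mk,
    ← ClassGroup.mk_canonicalEquiv L (FractionRing B)]
  congr 1
  ext1
  simp only [Units.coe_map]
  change FractionalIdeal.extended _ _ (FractionalIdeal.canonicalEquiv _ _ _ _) =
    FractionalIdeal.canonicalEquiv _ _ _ (FractionalIdeal.extended _ _ _)
  rw [FractionalIdeal.canonicalEquiv_eq_extended, FractionalIdeal.canonicalEquiv_eq_extended,
    FractionalIdeal.extended_extended, FractionalIdeal.extended_extended]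

namespace QuadraticOrder

variable {K : Type*} [Field K]

theorem classGroupMap_mk_eq_one_iff {A B : Subalgebra ℤ K} (h : A ≤ B) [IsFractionRing A K]
    [IsFractionRing B K] (I : (FractionalIdeal A⁰ K)ˣ) :
    classGroupMap h (ClassGroup.mk K I) = 1 ↔
      (Submodule.span B ((I : FractionalIdeal A⁰ K) : Set K)).IsPrincipal := by
  let _ : Algebra A B := (Subalgebra.inclusion h).toRingHom.toAlgebra
  have : Module.IsTorsionFree A B :=
    (Module.isTorsionFree_iff_algebraMap_injective).mpr (Subalgebra.inclusion_injective h)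
  have h1 : classGroupMap h (ClassGroup.mk K I) =
      ClassGroup.extendedHom A B (ClassGroup.mk K I) := rfl
  rw [h1, ClassGroup.extendedHom_mk_of_isFractionRing K K, ClassGroup.mk_eq_one_iff]
  simp only [Units.coe_map]
  change ((FractionalIdeal.extended _ _ _ : FractionalIdeal B⁰ K) : Submodule B K).IsPrincipal ↔ _
  rw [FractionalIdeal.coe_extended_eq_span]
  -- Both orders have fraction field `K`, so extending an ideal is just taking its `B`-span in `K`.
  have hmap (hy : A⁰ ≤ B⁰.comap (algebraMap A B)) : (IsLocalization.map K (algebraMap A B) hy : K →+* K) = RingHom.id K := by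
    refine IsLocalization.ringHom_ext A⁰ ?_
    rw [IsLocalization.map_comp]
    rfl
  rw [hmap]
  simp

/-! ### The kernel on class groups as units modulo scalars -/

section Preimage

variable {R O : Subalgebra ℤ K} {A : Type*} [CommRing A] {π : O →+* A}

/-- The preimage of `ℤ α` under `π : O → A`, as a module over the preimage `R` of `ℤ`. -/
def intMulPreimage (hR : ∀ x : K, x ∈ R ↔ ∃ y : O, (y : K) = x ∧ ∃ m : ℤ, π y = m) (α : A) :
    Submodule R K where
  carrier := {x | ∃ y : O, (y : K) = x ∧ ∃ m : ℤ, π y = m * α}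
  add_mem' := by
    rintro _ _ ⟨y, rfl, m, hy⟩ ⟨z, rfl, k, hz⟩
    exact ⟨y + z, rfl, m + k, by rw [map_add, hy, hz]; push_cast; ring⟩
  zero_mem' := ⟨0, rfl, 0, by simp⟩
  smul_mem' := by
    rintro ⟨_, hr⟩ _ ⟨z, rfl, k, hz⟩
    obtain ⟨y, rfl, m, hy⟩ := (hR _).1 hr
    exact ⟨y * z, rfl, m * k, by rw [map_mul, hy, hz]; push_cast; ring⟩

variable (hR : ∀ x : K, x ∈ R ↔ ∃ y : O, (y : K) = x ∧ ∃ m : ℤ, π y = m)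

theorem mem_intMulPreimage {α : A} {x : K} :
    x ∈ intMulPreimage hR α ↔ ∃ y : O, (y : K) = x ∧ ∃ m : ℤ, π y = m * α := Iff.rfl

theorem intMulPreimage_one : intMulPreimage hR 1 = 1 := by
  ext x
  simp only [mem_intMulPreimage, mul_one, Submodule.mem_one]
  rw [← hR]
  exact ⟨fun h => ⟨⟨x, h⟩, rfl⟩, by rintro ⟨y, rfl⟩; exact y.2⟩

/-- For the inclusion of the left side, lift `α`, `α⁻¹`, `β` to `a`, `a'`, `b` and put `k = y - m a
b`. Then `y = a (m b + a' k) + (1 - a a') k`, where `k` and `1 - a a'` lie in the kernel of `π`. -/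
theorem intMulPreimage_mul (hπ : Function.Surjective π) (α : Aˣ) (β : A) :
    intMulPreimage hR (α * β) = intMulPreimage hR α * intMulPreimage hR β := by
  apply le_antisymm
  · rintro _ ⟨y, rfl, m, hy⟩
    obtain ⟨a, ha⟩ := hπ α
    obtain ⟨a', ha'⟩ := hπ (α⁻¹ : Aˣ)
    obtain ⟨b, hb⟩ := hπ β
    set k := y - m * (a * b) with hk
    have hk0 : π k = 0 := by
      rw [hk, map_sub, map_mul, map_mul, map_intCast, hy, ha, hb, sub_self]
    have haa : π (1 - a * a') = 0 := by
      rw [map_sub, map_mul, map_one, ha, ha', Units.mul_inv, sub_self]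
    have hy' : (y : K) = (a : K) * ((m * b + a' * k : O) : K) + ((1 - a * a' : O) : K) * (k : K) := by
      have : y = a * (m * b + a' * k) + (1 - a * a') * k := by
        rw [hk]
        ring
      exact_mod_cast congrArg (fun z : O => (z : K)) this
    rw [hy']
    refine add_mem (Submodule.mul_mem_mul ⟨a, rfl, 1, ?_⟩ ⟨_, rfl, m, ?_⟩)
      (Submodule.mul_mem_mul ⟨_, rfl, 0, ?_⟩ ⟨k, rfl, 0, ?_⟩)
    · simp [ha]
    · simp [hk0, hb]
    · simp [haa]
    · simp [hk0]
  · rw [Submodule.mul_le]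
    rintro _ ⟨y, rfl, m, hy⟩ _ ⟨z, rfl, k, hz⟩
    exact ⟨y * z, rfl, m * k, by rw [map_mul, hy, hz]; push_cast; ring⟩

/-- The invertible fractional ideals `π⁻¹(ℤ α)` for the units `α` of `A`. -/
noncomputable def intMulPreimageHom (hπ : Function.Surjective π) [IsFractionRing R K] :
    Aˣ →* (FractionalIdeal R⁰ K)ˣ :=
  (FractionalIdeal.unitsMulEquivSubmodule (S := R⁰)).symm.toMonoidHom.comp <|
    MonoidHom.toHomUnits (G := Aˣ)
      { toFun := fun α => intMulPreimage hR (α : A)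
        map_one' := intMulPreimage_one hR
        map_mul' := fun α β => intMulPreimage_mul hR hπ α β }

theorem coe_intMulPreimageHom (hπ : Function.Surjective π) [IsFractionRing R K] (α : Aˣ) :
    ((intMulPreimageHom hR hπ α : FractionalIdeal R⁰ K) : Submodule R K) =
      intMulPreimage hR (α : A) := rfl

theorem one_mem_span_intMulPreimage (hπ : Function.Surjective π) (α : Aˣ) :
    (1 : K) ∈ Submodule.span O (intMulPreimage hR (α : A) : Set K) := by
  obtain ⟨a, ha⟩ := hπ α
  obtain ⟨a', ha'⟩ := hπ (α⁻¹ : Aˣ)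
  have h1 : (1 : K) = a' • (a : K) + ((1 - a * a' : O) : K) := by
    rw [Algebra.smul_def]
    change (1 : K) = (a' : K) * a + (1 - a * a')
    ring
  rw [h1]
  refine add_mem (Submodule.smul_mem _ _ (Submodule.subset_span ⟨a, rfl, 1, by simp [ha]⟩))
    (Submodule.subset_span ⟨_, rfl, 0, ?_⟩)
  rw [map_sub, map_mul, map_one, ha, ha', Units.mul_inv, sub_self]
  simp

theorem span_intMulPreimage (hπ : Function.Surjective π) (α : Aˣ) :
    Submodule.span O (intMulPreimage hR (α : A) : Set K) = Submodule.span O {1} := by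
  apply le_antisymm
  · rw [Submodule.span_le]
    rintro _ ⟨y, rfl, -⟩
    exact Submodule.mem_span_singleton.2 ⟨y, by rw [Algebra.smul_def, mul_one]; rfl⟩
  · rw [Submodule.span_singleton_le_iff_mem]
    exact one_mem_span_intMulPreimage hR hπ α

/-- A generator `c` also generates the `O`-span, which is `O`; so `c = ±1`, the ideal is `R`, and
`α` is an integer. Conversely, an integer that is a unit of `A` has an integer inverse, so `ℤ α =
ℤ`. -/
theorem intMulPreimage_isPrincipal_iff (hπ : Function.Surjective π)
    (hunits : ∀ c : K, c ≠ 0 → c ∈ O → c⁻¹ ∈ O → c = 1 ∨ c = -1)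
    (hinv : ∀ m : ℤ, IsUnit (m : A) → ∃ k : ℤ, (k * m : A) = 1) (α : Aˣ) :
    (intMulPreimage hR (α : A)).IsPrincipal ↔ ∃ m : ℤ, (α : A) = m := by
  constructor
  · rintro ⟨c, hc⟩
    have hone := one_mem_span_intMulPreimage hR hπ α
    have hspan : ∀ y ∈ Submodule.span O (intMulPreimage hR (α : A) : Set K),
        y ∈ Submodule.span O {c} := by
      intro y hy
      refine Submodule.span_le.2 ?_ hy
      intro x hx
      rw [hc, SetLike.mem_coe, Submodule.mem_span_singleton] at hx
      obtain ⟨⟨r, hr⟩, rfl⟩ := hx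
      obtain ⟨y, rfl, -⟩ := (hR _).1 hr
      exact Submodule.mem_span_singleton.2 ⟨y, rfl⟩
    obtain ⟨d, hd⟩ := Submodule.mem_span_singleton.1 (hspan 1 hone)
    replace hd : (d : K) * c = 1 := hd
    have hc0 : c ≠ 0 := right_ne_zero_of_mul_eq_one hd
    have hcO : c ∈ O := by
      have : c ∈ intMulPreimage hR (α : A) := hc ▸ Submodule.mem_span_singleton_self c
      obtain ⟨y, rfl, -⟩ := this
      exact y.2
    have hcpm := hunits c hc0 hcO (eq_inv_of_mul_eq_one_left hd ▸ d.2)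
    obtain ⟨a, ha⟩ := hπ α
    have ha1 : (a : K) ∈ intMulPreimage hR (α : A) := ⟨a, rfl, 1, by simp [ha]⟩
    rw [hc, Submodule.mem_span_singleton] at ha1
    obtain ⟨r, hr⟩ := ha1
    replace hr : (r : K) * c = a := hr
    have haR : (a : K) ∈ R := by
      rcases hcpm with rfl | rfl
      · rw [← hr, mul_one]
        exact r.2
      · rw [← hr, mul_neg_one]
        exact neg_mem r.2
    obtain ⟨y, hy, m, hm⟩ := (hR _).1 haR
    rw [Subtype.ext hy, ha] at hm
    exact ⟨m, hm⟩
  · rintro ⟨m, hm⟩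
    obtain ⟨k, hk⟩ := hinv m (hm ▸ α.isUnit)
    refine ⟨1, ?_⟩
    rw [← Submodule.one_eq_span, ← intMulPreimage_one hR]
    ext x
    simp only [mem_intMulPreimage]
    refine exists_congr fun y => and_congr_right fun _ => ?_
    rw [hm]
    constructor
    · rintro ⟨l, hl⟩
      exact ⟨l * m, by rw [hl]; push_cast; ring⟩
    · rintro ⟨l, hl⟩
      exact ⟨l * k, by rw [hl]; push_cast; rw [mul_assoc, hk]⟩

/-- As `I` generates `O` over `O`, its inverse `J` lies in `O`, and `I` contains the `O`-ideal `ker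
π ⊆ R`. So `I` is determined by its image in `A`; pairing with one well-chosen `j ∈ J` shows that
this image is a line. -/
theorem exists_eq_intMulPreimage (hle : R ≤ O) {p : ℤ}
    (hinv : ∀ m : ℤ, ¬ p ∣ m → ∃ k : ℤ, (k * m : A) = 1)
    (hunit : ∀ m : ℤ, IsUnit (m : A) → ¬ p ∣ m)
    {I J : Submodule R K} (hIJ : I * J = 1) (hIsub : ∀ x ∈ I, x ∈ O)
    (hI : (1 : K) ∈ Submodule.span O (I : Set K)) :
    ∃ α : Aˣ, I = intMulPreimage hR (α : A) := by
  have hmulR {x y : K} (hx : x ∈ I) (hy : y ∈ J) : x * y ∈ R := by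
    have : x * y ∈ I * J := Submodule.mul_mem_mul hx hy
    rw [hIJ, Submodule.mem_one] at this
    obtain ⟨r, hr⟩ := this
    rw [← hr]
    exact r.2
  have hJO : ∀ y ∈ J, y ∈ O := by
    intro y hy
    have : ∀ z ∈ Submodule.span O (I : Set K), y * z ∈ O := by
      intro z hz
      induction hz using Submodule.span_induction with
      | mem x hx => exact mul_comm x y ▸ hle (hmulR hx hy)
      | zero => simp
      | add a b _ _ ha hb => rw [mul_add]; exact add_mem ha hb
      | smul c a _ ha =>
        change y * (c * a) ∈ O
        rw [mul_left_comm]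
        exact mul_mem c.2 ha
    simpa using this 1 hI
  have hker : ∀ k : O, π k = 0 → (k : K) ∈ I := by
    have : ∀ z ∈ Submodule.span O (I : Set K), ∀ k : O, π k = 0 → (k : K) * z ∈ I := by
      intro z hz
      induction hz using Submodule.span_induction with
      | mem x hx =>
        intro k hk
        exact I.smul_mem ⟨k, (hR _).2 ⟨k, rfl, 0, by simp [hk]⟩⟩ hx
      | zero => simp
      | add a b _ _ ha hb =>
        intro k hk
        rw [mul_add]
        exact add_mem (ha k hk) (hb k hk)
      | smul c a _ ha =>
        intro k hk
        have := ha (k * c) (by rw [map_mul, hk, zero_mul])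
        rwa [MulMemClass.coe_mul, mul_assoc] at this
    intro k hk
    simpa using this 1 hI k hk
  -- Otherwise `I * J` would lie in `π⁻¹(pℤ)`, which does not contain `1`.
  obtain ⟨i, hi, j, hj, m, hm, hpm⟩ : ∃ i : O, (i : K) ∈ I ∧ ∃ j : O, (j : K) ∈ J ∧
      ∃ m : ℤ, π (i * j) = m ∧ ¬ p ∣ m := by
    by_contra! hcon
    have : ∀ z ∈ I * J, ∃ y : O, (y : K) = z ∧ ∃ m : ℤ, π y = m ∧ p ∣ m := by
      intro z hz
      induction hz using Submodule.mul_induction_on' with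
      | mem_mul_mem x hx y hy =>
        obtain ⟨w, hw, m, hm⟩ := (hR _).1 (hmulR hx hy)
        have hw' : w = ⟨x, hIsub x hx⟩ * ⟨y, hJO y hy⟩ := Subtype.ext hw
        exact ⟨w, hw, m, hm, hcon ⟨x, hIsub x hx⟩ hx ⟨y, hJO y hy⟩ hy m (hw' ▸ hm)⟩
      | add x _ y _ hx hy =>
        obtain ⟨x, rfl, m, hm, hpm⟩ := hx
        obtain ⟨y, rfl, k, hk, hpk⟩ := hy
        exact ⟨x + y, rfl, m + k, by rw [map_add, hm, hk, Int.cast_add], dvd_add hpm hpk⟩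
    obtain ⟨y, hy, m, hm, hpm⟩ := this 1 (hIJ ▸ Submodule.one_le.1 le_rfl)
    have hy1 : y = 1 := Subtype.ext hy
    rw [hy1, map_one] at hm
    exact hunit m (hm ▸ isUnit_one) hpm
  obtain ⟨k, hk⟩ := hinv m hpm
  have hα : π i * (π j * k) = 1 := by
    rw [← mul_assoc, ← map_mul, hm, mul_comm, hk]
  refine ⟨Units.mkOfMulEqOne _ _ hα, ?_⟩
  rw [Units.val_mkOfMulEqOne]
  ext x
  constructor
  · intro hx
    refine ⟨⟨x, hIsub x hx⟩, rfl, ?_⟩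
    obtain ⟨w, hw, l, hl⟩ := (hR _).1 (hmulR hx hj)
    have hw' : w = ⟨x, hIsub x hx⟩ * j := Subtype.ext hw
    rw [hw', map_mul] at hl
    refine ⟨l * k, ?_⟩
    push_cast
    rw [← hl]
    linear_combination -(π ⟨x, hIsub x hx⟩) * hα
  · rintro ⟨y, rfl, l, hl⟩
    have h1 : (y : K) = ((y - l * i : O) : K) + l * (i : K) := by
      push_cast
      ring
    rw [h1]
    refine add_mem (hker _ ?_) ?_
    · rw [map_sub, map_mul, map_intCast, hl, sub_self]
    · exact I.smul_mem (l : R) hi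

/-- The kernel of `cl(R) → cl(O)`, where `R` is the preimage of `ℤ` in `O` under `O → A`, is a
quotient of `Aˣ` by the units that come from `ℤ`. -/
theorem exists_hom_ker_classGroupMap
    (hR : ∀ x : K, x ∈ R ↔ ∃ y : O, (y : K) = x ∧ ∃ m : ℤ, π y = m) (hle : R ≤ O) [IsFractionRing R K] [IsFractionRing O K]
    (hπ : Function.Surjective π)
    (hunits : ∀ c : K, c ≠ 0 → c ∈ O → c⁻¹ ∈ O → c = 1 ∨ c = -1) {p : ℤ}
    (hinv : ∀ m : ℤ, ¬ p ∣ m → ∃ k : ℤ, (k * m : A) = 1)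
    (hunit : ∀ m : ℤ, IsUnit (m : A) → ¬ p ∣ m) :
    ∃ f : Aˣ →* (classGroupMap hle).ker, Function.Surjective f ∧
      ∀ α, f α = 1 ↔ ∃ m : ℤ, (α : A) = m := by
  refine ⟨((ClassGroup.mk K).comp (intMulPreimageHom hR hπ)).codRestrict _ fun α => ?_, ?_, ?_⟩
  · rw [MonoidHom.mem_ker]
    refine (classGroupMap_mk_eq_one_iff hle _).2 ⟨1, ?_⟩
    exact span_intMulPreimage hR hπ α
  · rintro ⟨g, hg⟩
    obtain ⟨J, rfl⟩ : ∃ J, ClassGroup.mk K J = g := ClassGroup.induction K (fun J => ⟨J, rfl⟩) g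
    obtain ⟨c, hc⟩ := (classGroupMap_mk_eq_one_iff hle J).1 hg
    have hc0 : c ≠ 0 := by
      rintro rfl
      rw [Submodule.span_zero_singleton, Submodule.span_eq_bot] at hc
      refine J.ne_zero (FractionalIdeal.eq_zero_iff.2 fun x hx => hc x hx)
    -- Dividing by the generator `c` of the `O`-span keeps the class and makes the `O`-span equal to
    -- `O`.
    let I := toPrincipalIdeal R K (Units.mk0 c hc0)⁻¹ * J
    have hmk : ClassGroup.mk K I = ClassGroup.mk K J := by
      rw [map_mul, ClassGroup.mk_eq_one_iff.2, one_mul]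
      rw [coe_toPrincipalIdeal, FractionalIdeal.coe_spanSingleton]
      exact ⟨_, rfl⟩
    have hmem (x : K) : x ∈ (I : FractionalIdeal R⁰ K) ↔ c * x ∈ (J : FractionalIdeal R⁰ K) := by
      rw [Units.val_mul, coe_toPrincipalIdeal, FractionalIdeal.mem_singleton_mul]
      simp only [Units.val_inv_eq_inv_val, Units.val_mk0]
      constructor
      · rintro ⟨y, hy, rfl⟩
        rwa [mul_inv_cancel_left₀ hc0]
      · intro hx
        exact ⟨_, hx, by rw [inv_mul_cancel_left₀ hc0]⟩
    obtain ⟨α, hα⟩ := exists_eq_intMulPreimage hR hle hinv hunit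
      (I := ((I : FractionalIdeal R⁰ K) : Submodule R K))
      (J := (((I⁻¹ : (FractionalIdeal R⁰ K)ˣ) : FractionalIdeal R⁰ K) : Submodule R K))
      (by rw [← FractionalIdeal.coe_mul, Units.mul_inv, FractionalIdeal.coe_one])
      (by
        intro x hx
        have h1 : c * x ∈ Submodule.span O ((J : FractionalIdeal R⁰ K) : Set K) :=
          Submodule.subset_span ((hmem x).1 hx)
        rw [hc, Submodule.mem_span_singleton] at h1
        obtain ⟨o, ho⟩ := h1
        replace ho : (o : K) * c = c * x := ho
        rw [mul_comm] at ho
        exact mul_left_cancel₀ hc0 ho ▸ o.2)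
      (by
        have h1 : ∀ y ∈ Submodule.span O ((J : FractionalIdeal R⁰ K) : Set K), c⁻¹ * y ∈
            Submodule.span O ((I : FractionalIdeal R⁰ K) : Set K) := by
          intro y hy
          induction hy using Submodule.span_induction with
          | mem x hx =>
            refine Submodule.subset_span ((hmem _).2 ?_)
            rwa [mul_inv_cancel_left₀ hc0]
          | zero => simp
          | add a b _ _ ha hb => rw [mul_add]; exact add_mem ha hb
          | smul o a _ ha => rw [mul_smul_comm]; exact Submodule.smul_mem _ _ ha
        have h2 := h1 c (hc ▸ Submodule.mem_span_singleton_self c)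
        rwa [inv_mul_cancel₀ hc0] at h2)
    refine ⟨α, Subtype.ext ?_⟩
    change ClassGroup.mk K (intMulPreimageHom hR hπ α) = ClassGroup.mk K J
    rw [← hmk]
    congr 1
    ext1
    apply FractionalIdeal.coeToSubmodule_injective
    exact hα.symm
  · intro α
    rw [Subtype.ext_iff]
    change ClassGroup.mk K (intMulPreimageHom hR hπ α) = 1 ↔ _
    rw [ClassGroup.mk_eq_one_iff, coe_intMulPreimageHom]
    exact intMulPreimage_isPrincipal_iff hR hπ hunits (fun m hm => hinv m (hunit m hm)) α

end Preimage

end QuadraticOrder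

/-! ### Orders and their reduction mod `N` -/

namespace QuadraticOrder

variable {K : Type*} [Field K]

theorem IsOrder.isIntegral [CharZero K] {O : Subalgebra ℤ K} (hO : IsOrder O) {x : K}
    (hx : x ∈ O) : IsIntegral ℤ x :=
  IsIntegral.of_mem_of_fg O hO.fg x hx

theorem IsOrder.exists_intCast_mul_mem [CharZero K] {O : Subalgebra ℤ K} (hO : IsOrder O) (x : K) :
    ∃ m : ℤ, m ≠ 0 ∧ m * x ∈ O := by
  have hx : x ∈ Submodule.span ℚ (O : Set K) := hO.span_eq_top ▸ Submodule.mem_top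
  induction hx using Submodule.span_induction with
  | mem x hx => exact ⟨1, one_ne_zero, by simpa using hx⟩
  | zero => exact ⟨1, one_ne_zero, by simp⟩
  | add x y _ _ hx hy =>
    obtain ⟨m, hm, hx⟩ := hx
    obtain ⟨k, hk, hy⟩ := hy
    refine ⟨m * k, mul_ne_zero hm hk, ?_⟩
    have h : ((m * k : ℤ) : K) * (x + y) = k * (m * x) + m * (k * y) := by
      push_cast
      ring
    rw [h]
    exact add_mem (mul_mem (intCast_mem O k) hx) (mul_mem (intCast_mem O m) hy)
  | smul q x _ hx =>
    obtain ⟨m, hm, hx⟩ := hx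
    refine ⟨m * q.den, mul_ne_zero hm (by exact_mod_cast q.den_ne_zero), ?_⟩
    have h : ((m * q.den : ℤ) : K) * (q • x) = q.num * (m * x) := by
      rw [Rat.smul_def]
      nth_rewrite 2 [← Rat.num_div_den q]
      have : (q.den : K) ≠ 0 := by exact_mod_cast q.den_ne_zero
      push_cast
      field_simp
    rw [h]
    exact mul_mem (intCast_mem O _) hx

theorem isFractionRing_of_exists [CharZero K] {O : Subalgebra ℤ K}
    (h : ∀ x : K, ∃ m : ℤ, m ≠ 0 ∧ m * x ∈ O) : IsFractionRing O K := by
  refine IsFractionRing.of_field O K fun x => ?_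
  obtain ⟨m, hm, hx⟩ := h x
  refine ⟨⟨_, hx⟩, m, ?_⟩
  have : (m : K) ≠ 0 := by exact_mod_cast hm
  change x = (m * x) / (algebraMap O K m)
  rw [map_intCast]
  field_simp

theorem IsOrder.isFractionRing [CharZero K] {O : Subalgebra ℤ K} (hO : IsOrder O) :
    IsFractionRing O K :=
  isFractionRing_of_exists hO.exists_intCast_mul_mem

theorem IsOrder.isFractionRing_intAddMul [CharZero K] {O : Subalgebra ℤ K} (hO : IsOrder O)
    {N : ℕ} (hN : N ≠ 0) : IsFractionRing (intAddMul N O) K := by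
  refine isFractionRing_of_exists fun x => ?_
  obtain ⟨m, hm, hx⟩ := hO.exists_intCast_mul_mem x
  exact ⟨N * m, mul_ne_zero (by exact_mod_cast hN) hm, 0, _, hx, by push_cast; ring⟩

/-- The index annihilates the quotient group; an infinite index counts as `0`, and then the claim is
trivial. -/
theorem conductor_mul_mem (O : Subalgebra ℤ K) {x : K} (hx : IsIntegral ℤ x) :
    (conductor O : K) * x ∈ O := by
  have h := AddSubgroup.nsmul_index_mem
    ((Subalgebra.toSubmodule O).toAddSubgroup.addSubgroupOf
      (Subalgebra.toSubmodule (integralClosure ℤ K)).toAddSubgroup) ⟨x, hx⟩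
  rw [AddSubgroup.mem_addSubgroupOf] at h
  rw [← nsmul_eq_mul]
  exact h

/-- If `δ² = D < 0` and `c O ⊆ ℤ + ℤ δ ⊆ O` with `c` prime to `N`, then `O / N O` is the
quadratic algebra `(ℤ/N)[√D]`. -/
theorem exists_quotient_ringEquiv [CharZero K] {O : Subalgebra ℤ K} (δ : O) {D c : ℤ} {N : ℕ}
    (hD : D < 0) (hδ : δ ^ 2 = D) (hc : IsCoprime c N)
    (h : ∀ x : O, ∃ s t : ℤ, c * x = s + t * δ) :
    Nonempty ((O ⧸ Ideal.span {(N : O)}) ≃+* QuadraticAlgebra (ZMod N) (D : ZMod N) 0) := by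
  let Q := O ⧸ Ideal.span {(N : O)}
  let mk : O →+* Q := Ideal.Quotient.mk _
  have hmk (x : O) : mk x = 0 ↔ ∃ z, x = N * z :=
    Ideal.Quotient.eq_zero_iff_mem.trans Ideal.mem_span_singleton
  have hN : (N : Q) = 0 := by
    rw [← map_natCast mk]
    exact (hmk _).2 ⟨1, by simp⟩
  have hδK : (δ : K) ^ 2 = (D : K) := by exact_mod_cast congrArg (fun z : O => (z : K)) hδ
  have hinj (a b : ℤ) (hab : mk (a + b * δ) = 0) : (N : ℤ) ∣ a ∧ (N : ℤ) ∣ b := by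
    obtain ⟨z, hz⟩ := (hmk _).1 hab
    obtain ⟨s, t, hst⟩ := h z
    -- Multiply `a + bδ = N z` by `c` and compare coefficients; `c` then cancels because it is prime
    -- to `N`.
    have h1 : ((c * a - N * s : ℤ) : K) + ((c * b - N * t : ℤ) : K) * δ = 0 := by
      have hz' := congrArg (fun z : O => (z : K)) hz
      have hst' := congrArg (fun z : O => (z : K)) hst
      simp only [AddMemClass.coe_add, MulMemClass.coe_mul] at hz' hst'
      push_cast at hz' hst' ⊢
      linear_combination c * hz' + N * hst'
    obtain ⟨h2, h3⟩ := Int.cast_add_mul_eq_zero hδK hD h1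
    exact ⟨hc.symm.dvd_of_dvd_mul_left ⟨s, by linarith⟩,
      hc.symm.dvd_of_dvd_mul_left ⟨t, by linarith⟩⟩
  have hchar : CharP Q N := by
    refine ⟨fun m => ?_⟩
    constructor
    · intro hm
      have := hinj m 0 (by simpa using hm)
      exact_mod_cast this.1
    · rintro ⟨k, rfl⟩
      rw [Nat.cast_mul, hN, zero_mul]
  let j : ZMod N →+* Q := ZMod.castHom dvd_rfl Q
  have hj (a : ℤ) : j a = mk a := by rw [map_intCast, map_intCast]
  have hd : (mk δ) ^ 2 = j D := by rw [hj, ← map_pow, hδ]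
  let E := QuadraticAlgebra.evalHom j hd
  have hE (a b : ℤ) : E ⟨a, b⟩ = mk (a + b * δ) := by
    rw [QuadraticAlgebra.evalHom_apply, hj, hj, ← map_mul, ← map_add]
  refine ⟨(RingEquiv.ofBijective E ⟨?_, ?_⟩).symm⟩
  · rw [injective_iff_map_eq_zero]
    rintro ⟨a, b⟩ hab
    obtain ⟨a, rfl⟩ := ZMod.intCast_surjective a
    obtain ⟨b, rfl⟩ := ZMod.intCast_surjective b
    rw [hE] at hab
    obtain ⟨ha, hb⟩ := hinj a b hab
    rw [← ZMod.intCast_zmod_eq_zero_iff_dvd] at ha hb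
    rw [ha, hb]
    rfl
  · intro q
    obtain ⟨x, rfl⟩ := Ideal.Quotient.mk_surjective q
    obtain ⟨s, t, hst⟩ := h x
    obtain ⟨w, v, hw⟩ := hc
    -- With `w c + v N = 1`, `x` is congruent to `w c x = w s + w t δ` mod `N`.
    refine ⟨⟨(w * s : ℤ), (w * t : ℤ)⟩, ?_⟩
    rw [hE, ← sub_eq_zero]
    change mk _ - mk x = 0
    rw [← map_sub, hmk]
    refine ⟨-v * x, ?_⟩
    have hw' : (w * c + v * N : O) = 1 := by exact_mod_cast congrArg (fun z : ℤ => (z : O)) hw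
    push_cast
    linear_combination x * hw' - w * hst

end QuadraticOrder

/-! ### The main theorem -/

theorem mainTheorem6 {K : Type*} [Field K] [NumberField K]
    (hK : Module.finrank ℚ K = 2) (hd : NumberField.discr K < -4)
    (O : Subalgebra ℤ K) (hO : QuadraticOrder.IsOrder O)
    (p : ℕ) [Fact p.Prime] (hp : p ≠ 2)
    (hunram : Algebra.IsUnramifiedIn (NumberField.RingOfIntegers K) (Ideal.span {(p : ℤ)}))
    (n : ℕ) (hn : 1 ≤ n) (hcop : Nat.Coprime (p ^ n) (QuadraticOrder.conductor O)) :
    IsCyclic (QuadraticOrder.classGroupMap (QuadraticOrder.intAddMul_le (p ^ n) O)).ker ∧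
      (Nat.card (QuadraticOrder.classGroupMap (QuadraticOrder.intAddMul_le (p ^ n) O)).ker : ℤ) =
        (p : ℤ) ^ (n - 1) * ((p : ℤ) - legendreSym p (NumberField.discr K)) := by
  have hpp : p.Prime := Fact.out
  have hpi : Prime (p : ℤ) := Nat.prime_iff_prime_int.1 hpp
  have hn0 : n ≠ 0 := by omega
  have hN : p ^ n ≠ 0 := pow_ne_zero n hpp.ne_zero
  have hpd : ¬ (p : ℤ) ∣ NumberField.discr K :=
    (NumberField.not_dvd_discr_iff_isUnramifiedIn K (NumberField.RingOfIntegers K) hpi).2 hunram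
  set u := QuadraticOrder.conductor O with hu
  set d := NumberField.discr K with hdK
  have hpu : ¬ (p : ℤ) ∣ u := by
    rw [Int.natCast_dvd_natCast, ← hpp.coprime_iff_not_dvd]
    exact Nat.Coprime.coprime_dvd_left (dvd_pow_self p hn0) hcop
  have hu0 : (u : ℤ) ≠ 0 := fun h => hpu (h ▸ dvd_zero _)
  have hp2 : ¬ (p : ℤ) ∣ 2 := by
    intro h
    have h' : p ∣ 2 := by exact_mod_cast h
    exact hp ((Nat.prime_dvd_prime_iff_eq hpp Nat.prime_two).1 h')
  have hcoprime (m : ℤ) (hm : ¬ (p : ℤ) ∣ m) : IsCoprime m ((p ^ n : ℕ) : ℤ) := by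
    rw [Nat.cast_pow]
    exact ((hpi.coprime_iff_not_dvd.2 hm).symm).pow_right
  obtain ⟨θ, hθ, hhalf⟩ := NumberField.exists_sq_eq_discr hK
  rw [← hdK] at hθ
  have hθint : IsIntegral ℤ θ := by
    refine IsIntegral.of_pow two_pos ?_
    rw [hθ]
    exact isIntegral_algebraMap (x := d)
  -- `θ` itself need not lie in `O`. The factor `2u` needed to move `O` into `ℤ + ℤ δ` is prime to
  -- `p`.
  let δ : O := ⟨u * θ, QuadraticOrder.conductor_mul_mem O hθint⟩
  set D : ℤ := u ^ 2 * d with hDdef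
  have hD : D < 0 := by
    have : (0 : ℤ) < (u : ℤ) ^ 2 := by positivity
    nlinarith
  have hpD : ¬ (p : ℤ) ∣ D := fun h =>
    (hpi.dvd_or_dvd h).elim (fun h => hpu (hpi.dvd_of_dvd_pow h)) hpd
  have hDp : (D : ZMod p) ≠ 0 := by rwa [Ne, ZMod.intCast_zmod_eq_zero_iff_dvd]
  have hδ : δ ^ 2 = D := by
    apply Subtype.ext
    push_cast
    change ((u : K) * θ) ^ 2 = _
    rw [mul_pow, hθ, hDdef]
    push_cast
    rfl
  have hdiv (x : O) : ∃ s t : ℤ, ((2 * u : ℤ) : O) * x = s + t * δ := by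
    obtain ⟨t, f, h⟩ := hhalf x (hO.isIntegral x.2)
    refine ⟨u * t, f, Subtype.ext ?_⟩
    push_cast
    change (2 * u : K) * x = u * t + f * (u * θ)
    linear_combination u * h
  obtain ⟨E⟩ := QuadraticOrder.exists_quotient_ringEquiv δ hD hδ
    (hcoprime (2 * u) fun h => (hpi.dvd_or_dvd h).elim hp2 hpu) hdiv
  let A := QuadraticAlgebra (ZMod (p ^ n)) (D : ZMod (p ^ n)) 0
  let π : O →+* A := E.toRingHom.comp (Ideal.Quotient.mk _)
  have hπ : Function.Surjective π := E.surjective.comp Ideal.Quotient.mk_surjective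
  have hR (x : K) : x ∈ QuadraticOrder.intAddMul (p ^ n) O ↔
      ∃ y : O, (y : K) = x ∧ ∃ m : ℤ, π y = m := by
    have hπm (y : O) (m : ℤ) : π y = m ↔ ∃ b : O, y = m + (p ^ n : ℕ) * b := by
      rw [← sub_eq_zero, ← map_intCast π, ← map_sub]
      change E (Ideal.Quotient.mk _ _) = 0 ↔ _
      rw [EmbeddingLike.map_eq_zero_iff, Ideal.Quotient.eq_zero_iff_mem,
        Ideal.mem_span_singleton]
      exact exists_congr fun b => sub_eq_iff_eq_add'
    constructor
    · rintro ⟨m, b, hb, rfl⟩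
      exact ⟨m + (p ^ n : ℕ) * ⟨b, hb⟩, by push_cast; rfl, m, (hπm _ _).2 ⟨_, rfl⟩⟩
    · rintro ⟨y, rfl, m, hy⟩
      obtain ⟨b, rfl⟩ := (hπm _ _).1 hy
      exact ⟨m, b, b.2, by push_cast; rfl⟩
  have hfrac := hO.isFractionRing
  have hfrac' := hO.isFractionRing_intAddMul hN
  obtain ⟨f, hf, hker⟩ := QuadraticOrder.exists_hom_ker_classGroupMap hR
    (QuadraticOrder.intAddMul_le (p ^ n) O) hπ
    (fun c hc0 hc hc' => NumberField.eq_one_or_neg_one_of_isIntegral_inv hK hd hc0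
      (hO.isIntegral hc) (hO.isIntegral hc')) (p := (p : ℤ))
    (by
      intro m hm
      obtain ⟨k, l, hkl⟩ := hcoprime m hm
      refine ⟨k, ?_⟩
      have h1 : ((k * m : ℤ) : ZMod (p ^ n)) = 1 := by
        rw [eq_sub_of_add_eq hkl, Int.cast_sub, Int.cast_mul, Int.cast_natCast,
          ZMod.natCast_self, mul_zero, sub_zero, Int.cast_one]
      rw [← Int.cast_mul]
      ext
      · rw [QuadraticAlgebra.re_intCast, h1]
        rfl
      · rw [QuadraticAlgebra.im_intCast]
        rfl)
    (by
      intro m hm hpm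
      rw [QuadraticAlgebra.isUnit_iff_castHom_norm hn0] at hm
      rw [← ZMod.intCast_zmod_eq_zero_iff_dvd] at hpm
      refine hm ?_
      rw [QuadraticAlgebra.re_intCast, QuadraticAlgebra.im_intCast, map_intCast, hpm, map_zero]
      ring)
  have hker' (x : Aˣ) : f x = 1 ↔ (x : A).im = 0 := by
    rw [hker]
    constructor
    · rintro ⟨m, hm⟩
      rw [hm, QuadraticAlgebra.im_intCast]
    · intro h
      obtain ⟨m, hm⟩ := ZMod.intCast_surjective (x : A).re
      refine ⟨m, ?_⟩
      ext
      · rw [QuadraticAlgebra.re_intCast, hm]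
      · rw [QuadraticAlgebra.im_intCast, h]
  refine ⟨QuadraticAlgebra.isCyclic_of_ker hn0 hp hDp hf hker', ?_⟩
  -- The square `u²` in `D` has Legendre symbol `1`, as `p` does not divide `u`.
  rw [QuadraticAlgebra.card_of_ker hn0 hp hf hker', hDdef, legendreSym.mul, legendreSym.sq_one',
    one_mul]
  rwa [Ne, Int.cast_natCast, ← Int.cast_natCast, ZMod.intCast_zmod_eq_zero_iff_dvd]
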